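/- Let $\mathcal E$ and $\mathcal I$ be finite sets with $n$ and $m$ elements (labelling the external and the internal lines of a graph), and let $a_i>0$ for $i\in\mathcal I$. Put $\mathcal H=\bigoplus_{e\in\mathcal E}L^2([0,\infty))\oplus\bigoplus_{i\in\mathcal I}L^2([0,a_i])$. For $\psi\in\mathcal H$ whose components $\psi_e$, $\psi_i$ lie in the Sobolev spaces $W^{2,2}(0,\infty)$, $W^{2,2}(0,a_i)$, define the vectors in $\mathbb C^{n+2m}$ $$\underline\psi=\big((\psi_e(0))_{e},(\psi_i(0))_{i},(\psi_i(a_i))_{i}\big)^T,\qquad \underline\psi'=\big((\psi_e'(0))_{e},(\psi_i'(0))_{i},(-\psi_i'(a_i))_{i}\big)^T .$$ Let $A,B$ be complex $(n+2m)\times(n+2m)$ matrices such that the $(n+2m)\times 2(n+2m)$ matrix $(A,B)$ has rank $n+2m$ and $AB^\dagger$ is self-adjoint. Let $\Delta(A,B)$ be the operator in $\mathcal H$ acting as $\psi\mapsto\psi''$ componentwise, with domain the set of all $\psi$ as above that satisfy $A\underline\psi+B\underline\psi'=0$. For $E>0$ let $e^{\pm i\sqrt E\underline a}$ be the diagonal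 $m\times m$ matrix with entries $e^{\pm i\sqrt E a_j}$, and let $$Z_{A,B}(E)=A\begin{pmatrix}\mathbb I&0&0\\0&\mathbb I&\mathbb I\\0&e^{i\sqrt E\underline a}&e^{-i\sqrt E\underline a}\end{pmatrix}+i\sqrt E\,B\begin{pmatrix}\mathbb I&0&0\\0&\mathbb I&-\mathbb I\\0&-e^{i\sqrt E\underline a}&e^{-i\sqrt E\underline a}\end{pmatrix}.$$ Theorem 3.1. The set $\Sigma_{A,B}=\{E>0:\det Z_{A,B}(E)=0\}$ equals the set of positive eigenvalues of $-\Delta(A,B)$. This set is discrete and has no accumulation point in $\mathbb R$. -/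

import Mathlib

open MeasureTheory Set Filter Topology
open scoped ContDiff Matrix ENNReal

namespace QuantumGraph

/-- The closed interval of a line of the graph: the half line `[0, ∞)` for an external line
`e : 𝓔`, and `[0, a i]` for an internal line `i : 𝓘`. -/
def edge {𝓔 𝓘 : Type*} (a : 𝓘 → ℝ) : 𝓔 ⊕ 𝓘 → Set ℝ
  | .inl _ => Ici 0
  | .inr i => Icc 0 (a i)

/-- The Hilbert space `⨁_{e ∈ 𝓔} L²([0, ∞)) ⊕ ⨁_{i ∈ 𝓘} L²([0, a i])`. -/
abbrev HilbertSpace (𝓔 : Type*) {𝓘 : Type*} (a : 𝓘 → ℝ) : Type _ :=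
  PiLp 2 fun j : 𝓔 ⊕ 𝓘 => Lp ℂ 2 (volume.restrict (edge a j))

/-- `g` is the generalized (weak) derivative of `f` on the set `U` (used for open `U`): one has
`∫_U φ' f = - ∫_U φ g` for all smooth `φ` with compact support contained in `U`. -/
def IsWeakDeriv (U : Set ℝ) (f g : ℝ → ℂ) : Prop :=
  ∀ φ : ℝ → ℝ, ContDiff ℝ ∞ φ → HasCompactSupport φ → tsupport φ ⊆ U →
    ∫ x in U, deriv φ x • f x = - ∫ x in U, φ x • g x

/-- Componentwise generalized derivative on the open intervals underlying the lines. -/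
def IsWeakDerivOnGraph {𝓔 𝓘 : Type*} {a : 𝓘 → ℝ} (ψ χ : HilbertSpace 𝓔 a) : Prop :=
  ∀ j, IsWeakDeriv (interior (edge a j)) (ψ j) (χ j)

/-- `u` consists of the representatives of the components of `ψ` that are continuous on the
closed intervals; it serves to define values at the end points. -/
def IsContRep {𝓔 𝓘 : Type*} {a : 𝓘 → ℝ} (ψ : HilbertSpace 𝓔 a) (u : 𝓔 ⊕ 𝓘 → ℝ → ℂ) : Prop :=
  ∀ j, ContinuousOn (u j) (edge a j) ∧ (ψ j : ℝ → ℂ) =ᵐ[volume.restrict (edge a j)] u j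

/-- The column vector `((u_e(0))_e, (u_i(0))_i, (u_i(a_i))_i)` of boundary values. -/
def boundaryValue {𝓔 𝓘 : Type*} (a : 𝓘 → ℝ) (u : 𝓔 ⊕ 𝓘 → ℝ → ℂ) : 𝓔 ⊕ 𝓘 ⊕ 𝓘 → ℂ
  | .inl e => u (.inl e) 0
  | .inr (.inl i) => u (.inr i) 0
  | .inr (.inr i) => u (.inr i) (a i)

/-- The column vector `((v_e(0))_e, (v_i(0))_i, (-v_i(a_i))_i)`, to be applied to the first
derivatives `v`; with these signs it contains the inward derivatives at all end points. -/
def boundaryDeriv {𝓔 𝓘 : Type*} (a : 𝓘 → ℝ) (v : 𝓔 ⊕ 𝓘 → ℝ → ℂ) : 𝓔 ⊕ 𝓘 ⊕ 𝓘 → ℂ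
  | .inl e => v (.inl e) 0
  | .inr (.inl i) => v (.inr i) 0
  | .inr (.inr i) => - v (.inr i) (a i)

theorem interior_edge_ae_eq {𝓔 𝓘 : Type*} (a : 𝓘 → ℝ) (j : 𝓔 ⊕ 𝓘) :
    interior (edge a j) =ᵐ[volume] edge a j := by
  cases j with
  | inl e => simpa [edge] using (Ioi_ae_eq_Ici (μ := volume) (a := (0 : ℝ)))
  | inr i => simpa [edge] using (Ioo_ae_eq_Icc (μ := volume) (a := (0 : ℝ)) (b := a i))

theorem restrict_interior_edge {𝓔 𝓘 : Type*} (a : 𝓘 → ℝ) (j : 𝓔 ⊕ 𝓘) :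
    volume.restrict (interior (edge a j)) = volume.restrict (edge a j) :=
  Measure.restrict_congr_set (interior_edge_ae_eq a j)

theorem integrable_smul_Lp {S : Set ℝ} (f : Lp ℂ 2 (volume.restrict S)) {φ : ℝ → ℝ}
    (hφ : Continuous φ) (hc : HasCompactSupport φ) :
    Integrable (fun x => φ x • f x) (volume.restrict S) := by
  have h1 : MemLp φ 2 (volume.restrict S) := hφ.memLp_of_hasCompactSupport hc
  exact memLp_one_iff_integrable.1 ((Lp.memLp f).smul h1)

theorem isWeakDerivOnGraph_iff {𝓔 𝓘 : Type*} {a : 𝓘 → ℝ} {ψ χ : HilbertSpace 𝓔 a} :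
    IsWeakDerivOnGraph ψ χ ↔ ∀ j, ∀ φ : ℝ → ℝ, ContDiff ℝ ∞ φ → HasCompactSupport φ →
      tsupport φ ⊆ interior (edge a j) →
        ∫ x in edge a j, deriv φ x • ψ j x = - ∫ x in edge a j, φ x • χ j x := by
  simp only [IsWeakDerivOnGraph, IsWeakDeriv, restrict_interior_edge]

theorem IsWeakDerivOnGraph.zero {𝓔 𝓘 : Type*} {a : 𝓘 → ℝ} :
    IsWeakDerivOnGraph (0 : HilbertSpace 𝓔 a) 0 := by
  rw [isWeakDerivOnGraph_iff]
  intro j φ _ _ _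
  have h : ((0 : HilbertSpace 𝓔 a) j : ℝ → ℂ) =ᵐ[volume.restrict (edge a j)] 0 :=
    Lp.coeFn_zero _ _ _
  rw [integral_eq_zero_of_ae, integral_eq_zero_of_ae, neg_zero]
  · filter_upwards [h] with x hx
    rw [hx]; simp
  · filter_upwards [h] with x hx
    rw [hx]; simp

theorem IsWeakDerivOnGraph.add {𝓔 𝓘 : Type*} {a : 𝓘 → ℝ} {ψ χ ψ' χ' : HilbertSpace 𝓔 a}
    (h : IsWeakDerivOnGraph ψ χ) (h' : IsWeakDerivOnGraph ψ' χ') :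
    IsWeakDerivOnGraph (ψ + ψ') (χ + χ') := by
  rw [isWeakDerivOnGraph_iff] at *
  have key : ∀ (j : 𝓔 ⊕ 𝓘) (f g : HilbertSpace 𝓔 a) (η : ℝ → ℝ), Continuous η →
      HasCompactSupport η → ∫ x in edge a j, η x • (f + g) j x =
        (∫ x in edge a j, η x • f j x) + ∫ x in edge a j, η x • g j x := by
    intro j f g η hη hc
    rw [← integral_add (integrable_smul_Lp _ hη hc) (integrable_smul_Lp _ hη hc)]
    refine integral_congr_ae ?_
    filter_upwards [Lp.coeFn_add (f j) (g j)] with x hx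
    rw [PiLp.add_apply, hx, Pi.add_apply, smul_add]
  intro j φ h1 h2 h3
  rw [key j _ _ _ (h1.continuous_deriv (by simp)) h2.deriv, key j _ _ _ h1.continuous h2,
    h j φ h1 h2 h3, h' j φ h1 h2 h3]
  ring

theorem IsWeakDerivOnGraph.smul {𝓔 𝓘 : Type*} {a : 𝓘 → ℝ} (c : ℂ) {ψ χ : HilbertSpace 𝓔 a}
    (h : IsWeakDerivOnGraph ψ χ) : IsWeakDerivOnGraph (c • ψ) (c • χ) := by
  rw [isWeakDerivOnGraph_iff] at *
  have key : ∀ (j : 𝓔 ⊕ 𝓘) (f : HilbertSpace 𝓔 a) (η : ℝ → ℝ),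
      ∫ x in edge a j, η x • (c • f) j x = c * ∫ x in edge a j, η x • f j x := by
    intro j f η
    rw [← integral_const_mul]
    refine integral_congr_ae ?_
    filter_upwards [Lp.coeFn_smul c (f j)] with x hx
    rw [PiLp.smul_apply, hx, Pi.smul_apply, Complex.real_smul, Complex.real_smul, smul_eq_mul]
    ring
  intro j φ h1 h2 h3
  rw [key, key, h j φ h1 h2 h3]
  ring

/-- A generalized derivative is unique. -/
theorem IsWeakDerivOnGraph.eq_zero {𝓔 𝓘 : Type*} {a : 𝓘 → ℝ} {χ : HilbertSpace 𝓔 a}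
    (h : IsWeakDerivOnGraph 0 χ) : χ = 0 := by
  rw [isWeakDerivOnGraph_iff] at h
  ext1 j
  have hloc : LocallyIntegrableOn (χ j : ℝ → ℂ) (interior (edge a j)) volume := by
    have h1 : LocallyIntegrable (χ j : ℝ → ℂ) (volume.restrict (edge a j)) :=
      (Lp.memLp (χ j)).locallyIntegrable (by norm_num)
    exact (locallyIntegrableOn_of_locallyIntegrable_restrict h1).mono_set interior_subset
  have h2 := isOpen_interior.ae_eq_zero_of_integral_contDiff_smul_eq_zero hloc ?_
  · rw [PiLp.zero_apply, Lp.eq_zero_iff_ae_eq_zero]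
    have h3 := (ae_restrict_iff' isOpen_interior.measurableSet).2 h2
    rwa [restrict_interior_edge a j] at h3
  · intro g hg hc hs
    have h3 := h j g hg hc hs
    have h4 : ∫ x in edge a j, deriv g x • (0 : HilbertSpace 𝓔 a) j x = 0 := by
      refine integral_eq_zero_of_ae ?_
      filter_upwards [Lp.coeFn_zero ℂ 2 (volume.restrict (edge a j))] with x hx
      rw [PiLp.zero_apply, hx]; simp
    rw [h4, eq_comm, neg_eq_zero, setIntegral_eq_integral_of_forall_compl_eq_zero] at h3
    · exact h3
    · intro x hx
      have : g x = 0 := image_eq_zero_of_notMem_tsupport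
        fun hx' => hx (interior_subset (hs hx'))
      simp [this]

/-- The graph of the operator `Δ(A, B)`: the pairs `(ψ, ψ'')` for which the first and the second
generalized derivatives `ψ'`, `ψ''` exist in the Hilbert space (that is, all components are in
`W^{2,2}`) and `A ψ̲ + B ψ̲' = 0` holds for the boundary values of `ψ` and of `ψ'`. -/
def laplacianGraph {𝓔 𝓘 : Type*} [Fintype 𝓔] [Fintype 𝓘] (a : 𝓘 → ℝ)
    (A B : Matrix (𝓔 ⊕ 𝓘 ⊕ 𝓘) (𝓔 ⊕ 𝓘 ⊕ 𝓘) ℂ) :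
    Submodule ℂ (HilbertSpace 𝓔 a × HilbertSpace 𝓔 a) where
  carrier := {p | ∃ ψ' : HilbertSpace 𝓔 a,
    IsWeakDerivOnGraph p.1 ψ' ∧ IsWeakDerivOnGraph ψ' p.2 ∧
    ∃ u v : 𝓔 ⊕ 𝓘 → ℝ → ℂ, IsContRep p.1 u ∧ IsContRep ψ' v ∧
      A *ᵥ boundaryValue a u + B *ᵥ boundaryDeriv a v = 0}
  zero_mem' := by
    have h0 : IsContRep (0 : HilbertSpace 𝓔 a) 0 := fun j =>
      ⟨continuousOn_const, Lp.coeFn_zero _ _ _⟩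
    refine ⟨0, .zero, .zero, 0, 0, h0, h0, ?_⟩
    have h1 : boundaryValue a (0 : 𝓔 ⊕ 𝓘 → ℝ → ℂ) = 0 := by
      ext (e | i | i) <;> rfl
    have h2 : boundaryDeriv a (0 : 𝓔 ⊕ 𝓘 → ℝ → ℂ) = 0 := by
      ext (e | i | i) <;> simp [boundaryDeriv]
    rw [h1, h2, Matrix.mulVec_zero, Matrix.mulVec_zero, add_zero]
  add_mem' := by
    have hr : ∀ {f g : HilbertSpace 𝓔 a} {u v}, IsContRep f u → IsContRep g v →
        IsContRep (f + g) (u + v) := fun {f g u v} hu hv j =>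
      ⟨(hu j).1.add (hv j).1, (Lp.coeFn_add (f j) (g j)).trans ((hu j).2.add (hv j).2)⟩
    rintro p q ⟨p', hp, hp', u, v, hu, hv, h⟩ ⟨q', hq, hq', w, z, hw, hz, h'⟩
    refine ⟨p' + q', hp.add hq, hp'.add hq', u + w, v + z, hr hu hw, hr hv hz, ?_⟩
    have h1 : boundaryValue a (u + w) = boundaryValue a u + boundaryValue a w := by
      ext (e | i | i) <;> rfl
    have h2 : boundaryDeriv a (v + z) = boundaryDeriv a v + boundaryDeriv a z := by
      ext (e | i | i) <;> simp [boundaryDeriv]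
      ring
    rw [h1, h2, Matrix.mulVec_add, Matrix.mulVec_add, add_add_add_comm, h, h', add_zero]
  smul_mem' := by
    have hr : ∀ (c : ℂ) {f : HilbertSpace 𝓔 a} {u}, IsContRep f u →
        IsContRep (c • f) (c • u) := fun c {f u} hu j =>
      ⟨(hu j).1.const_smul c, (Lp.coeFn_smul c (f j)).trans ((hu j).2.const_smul c)⟩
    rintro c p ⟨p', hp, hp', u, v, hu, hv, h⟩
    refine ⟨c • p', hp.smul c, hp'.smul c, c • u, c • v, hr c hu, hr c hv, ?_⟩
    have h1 : boundaryValue a (c • u) = c • boundaryValue a u := by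
      ext (e | i | i) <;> rfl
    have h2 : boundaryDeriv a (c • v) = c • boundaryDeriv a v := by
      ext (e | i | i) <;> simp [boundaryDeriv]
    rw [h1, h2, Matrix.mulVec_smul, Matrix.mulVec_smul, ← smul_add, h, smul_zero]

/-- The operator `Δ(A, B)` in the Hilbert space: it maps `ψ` to `ψ''`, and its domain consists of
the `ψ` in `W^{2,2}` with `A ψ̲ + B ψ̲' = 0`. -/
noncomputable def laplacian {𝓔 𝓘 : Type*} [Fintype 𝓔] [Fintype 𝓘] (a : 𝓘 → ℝ)
    (A B : Matrix (𝓔 ⊕ 𝓘 ⊕ 𝓘) (𝓔 ⊕ 𝓘 ⊕ 𝓘) ℂ) : HilbertSpace 𝓔 a →ₗ.[ℂ] HilbertSpace 𝓔 a :=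
  (laplacianGraph a A B).toLinearPMap

/-- The set of pairs above is indeed the graph of an operator. -/
theorem laplacian_graph {𝓔 𝓘 : Type*} [Fintype 𝓔] [Fintype 𝓘] (a : 𝓘 → ℝ)
    (A B : Matrix (𝓔 ⊕ 𝓘 ⊕ 𝓘) (𝓔 ⊕ 𝓘 ⊕ 𝓘) ℂ) :
    (laplacian a A B).graph = laplacianGraph a A B := by
  refine Submodule.toLinearPMap_graph_eq _ ?_
  rintro ⟨x, y⟩ ⟨z, h1, h2, -⟩ (rfl : x = 0)
  have hz : z = 0 := IsWeakDerivOnGraph.eq_zero h1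
  subst hz
  exact IsWeakDerivOnGraph.eq_zero h2

/-- `μ` is an eigenvalue of the (possibly unbounded) operator `T`. -/
def IsEigenvalue {H : Type*} [AddCommGroup H] [Module ℂ H] (T : H →ₗ.[ℂ] H) (μ : ℂ) : Prop :=
  ∃ ψ : T.domain, (ψ : H) ≠ 0 ∧ T ψ = μ • (ψ : H)

/-- The set `σ_{A,B}` of positive eigenvalues of `-Δ(A, B)`. -/
def positiveEigenvalues {𝓔 𝓘 : Type*} [Fintype 𝓔] [Fintype 𝓘] (a : 𝓘 → ℝ)
    (A B : Matrix (𝓔 ⊕ 𝓘 ⊕ 𝓘) (𝓔 ⊕ 𝓘 ⊕ 𝓘) ℂ) : Set ℝ :=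
  {E | 0 < E ∧ IsEigenvalue (-laplacian a A B) (E : ℂ)}

/-- The diagonal matrix `exp(i k a)`. -/
noncomputable def expDiag {𝓘 : Type*} [DecidableEq 𝓘] (a : 𝓘 → ℝ) (k : ℝ) : Matrix 𝓘 𝓘 ℂ :=
  Matrix.diagonal fun j => Complex.exp (Complex.I * (k : ℂ) * (a j : ℂ))

/-- The matrix `X(E)`. -/
noncomputable def matX {𝓔 𝓘 : Type*} [DecidableEq 𝓔] [DecidableEq 𝓘] (a : 𝓘 → ℝ) (E : ℝ) :
    Matrix (𝓔 ⊕ 𝓘 ⊕ 𝓘) (𝓔 ⊕ 𝓘 ⊕ 𝓘) ℂ :=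
  Matrix.fromBlocks 1 0 0
    (Matrix.fromBlocks 1 1 (expDiag a (Real.sqrt E)) (expDiag a (-Real.sqrt E)))

/-- The matrix `Y(E)`. -/
noncomputable def matY {𝓔 𝓘 : Type*} [DecidableEq 𝓔] [DecidableEq 𝓘] (a : 𝓘 → ℝ) (E : ℝ) :
    Matrix (𝓔 ⊕ 𝓘 ⊕ 𝓘) (𝓔 ⊕ 𝓘 ⊕ 𝓘) ℂ :=
  Matrix.fromBlocks 1 0 0
    (Matrix.fromBlocks 1 (-1) (-expDiag a (Real.sqrt E)) (expDiag a (-Real.sqrt E)))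

/-- The matrix `Z_{A,B}(E) = A X(E) + i √E B Y(E)`. -/
noncomputable def matZ {𝓔 𝓘 : Type*} [Fintype 𝓔] [Fintype 𝓘] [DecidableEq 𝓔] [DecidableEq 𝓘]
    (a : 𝓘 → ℝ) (A B : Matrix (𝓔 ⊕ 𝓘 ⊕ 𝓘) (𝓔 ⊕ 𝓘 ⊕ 𝓘) ℂ) (E : ℝ) :
    Matrix (𝓔 ⊕ 𝓘 ⊕ 𝓘) (𝓔 ⊕ 𝓘 ⊕ 𝓘) ℂ :=
  A * matX a E + (Complex.I * (Real.sqrt E : ℂ)) • (B * matY a E)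

/-- The exceptional set `Σ_{A,B}` of all `E > 0` with `det Z_{A,B}(E) = 0`. -/
def exceptionalSet {𝓔 𝓘 : Type*} [Fintype 𝓔] [Fintype 𝓘] [DecidableEq 𝓔] [DecidableEq 𝓘]
    (a : 𝓘 → ℝ) (A B : Matrix (𝓔 ⊕ 𝓘 ⊕ 𝓘) (𝓔 ⊕ 𝓘 ⊕ 𝓘) ℂ) : Set ℝ :=
  {E | 0 < E ∧ (matZ a A B E).det = 0}

end QuantumGraph

namespace QuantumGraph

/-! Write `E = k²` with `k > 0`. On each line the solutions of `-u'' = k²u` are combinations of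
`exp(ikx)` and `exp(-ikx)`, and `Z` maps a vector of amplitudes, with only `exp(ikx)` on the
external lines, to `A ψ̲ + B ψ̲'` of the resulting function (`entireZ_mulVec`). An eigenfunction
therefore yields a nonzero kernel vector of `Z`, once generalized solutions are known to be
classical (`exists_amplitude`).

The converse has one obstacle: a wave `exp(ikx)` on a half line is not square integrable. The
boundary conditions define a Lagrangian subspace, so the total flux `Im ⟨ψ̲, ψ̲'⟩` vanishes
(`im_star_dotProduct_eq_zero`). Green's formula evaluates the same flux as `Re k · ∑ |s_e|² + Im k²
· ∑ ∫ |ψ_i|²`. For `k > 0` this forces all external amplitudes `s_e` to vanish, and the function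
lies in the Hilbert space.

The identity persists for complex `k`. In the open first quadrant both coefficients are positive, so
`Z` is injective there. Hence `det Z`, an entire function of `k`, is not identically zero; its zeros
are isolated, including near `k = 0`. -/

/-! ### Linear algebra of the boundary conditions -/

open scoped ComplexOrder in
/-- The kernel of `(A, B)` is a Lagrangian subspace if `(A, B)` has full rank and `A Bᴴ` is
Hermitian. -/
theorem im_star_dotProduct_eq_zero {n : Type*} [Fintype n] [DecidableEq n] {A B : Matrix n n ℂ}
    (hrank : (Matrix.fromCols A B).rank = Fintype.card n) (hAB : (A * Bᴴ).IsHermitian)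
    {x y : n → ℂ} (h : A *ᵥ x + B *ᵥ y = 0) : (star x ⬝ᵥ y).im = 0 := by
  set M := Matrix.fromCols A B with hM
  set C : Matrix (n ⊕ n) n ℂ := Matrix.fromRows Bᴴ (-Aᴴ) with hC
  have hBA : B * Aᴴ = A * Bᴴ := by
    have := hAB.eq
    rwa [Matrix.conjTranspose_mul, Matrix.conjTranspose_conjTranspose] at this
  have hMC : M * C = 0 := by
    rw [hM, hC, Matrix.fromCols_mul_fromRows, Matrix.mul_neg, hBA, add_neg_cancel]
  have hinjM : Function.Injective Mᴴ.mulVecLin := by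
    have hr : Mᴴ.rank = Fintype.card n := by rw [Matrix.rank_conjTranspose, hrank]
    rw [← LinearMap.ker_eq_bot, ← Submodule.finrank_eq_zero]
    have := LinearMap.finrank_range_add_finrank_ker Mᴴ.mulVecLin
    rw [Matrix.rank] at hr
    rw [hr, Module.finrank_fintype_fun_eq_card] at this
    omega
  -- The blocks of `C` are those of `Mᴴ` up to order and sign, so the two have the same kernel.
  have hinjC : Function.Injective C.mulVecLin := by
    rw [injective_iff_map_eq_zero]
    intro w hw
    rw [Matrix.mulVecLin_apply, hC, Matrix.fromRows_mulVec] at hw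
    have h1 : Bᴴ *ᵥ w = 0 := funext fun i => congrFun hw (.inl i)
    have h2 : Aᴴ *ᵥ w = 0 := by
      have : (-Aᴴ) *ᵥ w = 0 := funext fun i => congrFun hw (.inr i)
      rwa [Matrix.neg_mulVec, neg_eq_zero] at this
    apply hinjM
    rw [map_zero, Matrix.mulVecLin_apply, hM, Matrix.conjTranspose_fromCols_eq_fromRows_conjTranspose,
      Matrix.fromRows_mulVec, h1, h2]
    ext (i | i) <;> rfl
  have hle : LinearMap.range C.mulVecLin ≤ LinearMap.ker M.mulVecLin := by
    rintro _ ⟨w, rfl⟩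
    rw [LinearMap.mem_ker, Matrix.mulVecLin_apply, Matrix.mulVecLin_apply, Matrix.mulVec_mulVec,
      hMC, Matrix.zero_mulVec]
  -- With `N = Fintype.card n`, both spaces have dimension `N`: the range because `C` is injective,
  -- the kernel as `2N - N`.
  have heq : LinearMap.range C.mulVecLin = LinearMap.ker M.mulVecLin := by
    apply Submodule.eq_of_le_of_finrank_eq hle
    have h1 := LinearMap.finrank_range_add_finrank_ker M.mulVecLin
    have h2 := LinearMap.finrank_range_of_inj hinjC
    rw [Matrix.rank] at hrank
    rw [hrank, Module.finrank_fintype_fun_eq_card, Fintype.card_sum] at h1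
    rw [Module.finrank_fintype_fun_eq_card] at h2
    omega
  have hmem : Sum.elim x y ∈ LinearMap.ker M.mulVecLin := by
    rw [LinearMap.mem_ker, Matrix.mulVecLin_apply, hM, Matrix.fromCols_mulVec]
    simpa using h
  rw [← heq] at hmem
  obtain ⟨w, hw⟩ := hmem
  rw [Matrix.mulVecLin_apply, hC, Matrix.fromRows_mulVec] at hw
  have hx : x = Bᴴ *ᵥ w := funext fun i => (congrFun hw (.inl i)).symm
  have hy : y = -(Aᴴ *ᵥ w) := by
    rw [← Matrix.neg_mulVec]
    exact funext fun i => (congrFun hw (.inr i)).symm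
  have hher : (B * Aᴴ).IsHermitian := by rwa [hBA]
  rw [hx, hy, Matrix.star_mulVec, Matrix.conjTranspose_conjTranspose, dotProduct_neg,
    ← Matrix.dotProduct_mulVec, Matrix.mulVec_mulVec, Complex.neg_im, neg_eq_zero]
  exact hher.im_star_dotProduct_mulVec_self w

/-! ### Generalized and classical derivatives -/

/-- The lemma of du Bois-Reymond. -/
theorem exists_eqOn_const_of_integral_deriv_smul_eq_zero {U : Set ℝ} (hU : IsOpen U)
    (hUc : U.OrdConnected) (hne : U.Nonempty) {w : ℝ → ℂ} (hw : Continuous w)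
    (h : ∀ φ : ℝ → ℝ, ContDiff ℝ ∞ φ → HasCompactSupport φ → tsupport φ ⊆ U →
      ∫ x, deriv φ x • w x = 0) : ∃ c, EqOn w (fun _ => c) U := by
  obtain ⟨x₀, hx₀⟩ := hne
  obtain ⟨χ, hχU, hχc, hχs, hχr, hχ1⟩ :=
    exists_contDiff_tsupport_subset (n := ⊤) (hU.mem_nhds hx₀)
  have hχs : ContDiff ℝ ∞ χ := hχs
  have hint : ∀ θ : ℝ → ℝ, Continuous θ → HasCompactSupport θ →
      Integrable (fun x => θ x • w x) := fun θ hθ hc =>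
    (hθ.smul hw).integrable_of_hasCompactSupport hc.smul_right
  have hI : 0 < ∫ x, χ x := hχs.continuous.integral_pos_of_hasCompactSupport_nonneg_nonzero hχc
    (fun x => (hχr ⟨x, rfl⟩).1) (x := x₀) (by rw [hχ1]; exact one_ne_zero)
  set I := ∫ x, χ x with hIdef
  -- The only possible constant: the mean of `w` with weight `χ`.
  set c : ℂ := (I⁻¹ : ℝ) • ∫ x, χ x • w x with hcdef
  have key : ∀ θ : ℝ → ℝ, ContDiff ℝ ∞ θ → HasCompactSupport θ → tsupport θ ⊆ U →
      ∫ x, θ x • (w x - c) = 0 := by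
    intro θ hθ hθc hθU
    set J := ∫ x, θ x with hJ
    -- The multiple of `χ` is chosen so that `η` has integral zero; `η` is then the derivative of a
    -- test function, to which `h` applies.
    set η : ℝ → ℝ := fun x => θ x - (J / I) * χ x with hη
    have hηs : ContDiff ℝ ∞ η := hθ.sub (contDiff_const.mul hχs)
    set K := tsupport θ ∪ tsupport χ with hK
    have hKc : IsCompact K := IsCompact.union hθc hχc
    have hKn : K.Nonempty := ⟨x₀, Or.inr (subset_tsupport χ (by simp [hχ1]))⟩
    have hKU : K ⊆ U := union_subset hθU hχU
    set p := sInf K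
    set q := sSup K
    have hpq : Icc p q ⊆ U := hUc.out (hKU (hKc.sInf_mem hKn)) (hKU (hKc.sSup_mem hKn))
    have hη0 : ∀ x, x ∉ Icc p q → η x = 0 := by
      intro x hx
      have hxK : x ∉ K := fun hxK => hx ⟨csInf_le hKc.bddBelow hxK, le_csSup hKc.bddAbove hxK⟩
      have h1 : θ x = 0 := image_eq_zero_of_notMem_tsupport fun h => hxK (Or.inl h)
      have h2 : χ x = 0 := image_eq_zero_of_notMem_tsupport fun h => hxK (Or.inr h)
      simp [hη, h1, h2]
    have hη_int : ∫ x, η x = 0 := by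
      rw [hη, integral_sub (hθ.continuous.integrable_of_hasCompactSupport hθc)
        ((hχs.continuous.integrable_of_hasCompactSupport hχc).const_mul _), integral_const_mul,
        ← hIdef, ← hJ]
      field_simp
      ring
    -- Starting at `p - 1` rather than `p` makes the half-open interval of integration contain all
    -- of `[p, q]` as soon as `q < x`.
    set φ : ℝ → ℝ := fun x => ∫ t in (p - 1)..x, η t with hφ
    have hφd : ∀ x, HasDerivAt φ (η x) x := fun x =>
      intervalIntegral.integral_hasDerivAt_right (hηs.continuous.intervalIntegrable _ _)
        (hηs.continuous.stronglyMeasurableAtFilter _ _) hηs.continuous.continuousAt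
    have hφ' : deriv φ = η := funext fun x => (hφd x).deriv
    have hφs : ContDiff ℝ ∞ φ := by
      rw [contDiff_infty_iff_deriv, hφ']
      exact ⟨fun x => (hφd x).differentiableAt, hηs⟩
    have hφ0 : Function.support φ ⊆ Icc p q := by
      intro x hx
      by_contra hxn
      apply hx
      by_cases hxp : x < p
      · refine intervalIntegral.integral_zero_ae (Eventually.of_forall fun t ht => hη0 t ?_)
        intro htp
        have := (mem_uIoc.1 ht)
        rcases this with h1 | h1
        · linarith [htp.1, h1.2]
        · linarith [htp.1, h1.2]
      · have hqx : q < x := by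
          by_contra hqx
          exact hxn ⟨not_lt.1 hxp, not_lt.1 hqx⟩
        change ∫ t in (p - 1)..x, η t = 0
        rw [intervalIntegral.integral_eq_integral_of_support_subset, hη_int]
        intro t ht
        have : t ∈ Icc p q := by
          by_contra hn
          exact ht (hη0 t hn)
        exact ⟨by linarith [this.1], by linarith [this.2]⟩
    have hφt : tsupport φ ⊆ Icc p q := closure_minimal hφ0 isClosed_Icc
    have h0 := h φ hφs (HasCompactSupport.of_support_subset_isCompact isCompact_Icc hφ0)
      (hφt.trans hpq)
    rw [hφ'] at h0
    have h1 : ∫ x, η x • w x = (∫ x, θ x • w x) - (J / I) • ∫ x, χ x • w x := by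
      rw [← integral_smul, ← integral_sub (hint θ hθ.continuous hθc)
        (g := fun x => (J / I) • χ x • w x) ((hint χ hχs.continuous hχc).smul (J / I))]
      refine integral_congr_ae (Eventually.of_forall fun x => ?_)
      simp only [hη, sub_smul, mul_smul]
    have h2 : ∫ x, θ x • (w x - c) = (∫ x, θ x • w x) - J • c := by
      rw [hJ, ← integral_smul_const, ← integral_sub (hint θ hθ.continuous hθc)
        ((hθ.continuous.integrable_of_hasCompactSupport hθc).smul_const c)]
      simp only [smul_sub]
    rw [h2, hcdef, smul_smul, ← div_eq_mul_inv, ← h1, h0]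
  refine ⟨c, Measure.eqOn_open_of_ae_eq (μ := volume) ?_ hU hw.continuousOn continuousOn_const⟩
  have h1 := hU.ae_eq_zero_of_integral_contDiff_smul_eq_zero (μ := volume)
    (f := fun x => w x - c) ((hw.sub continuous_const).locallyIntegrable.locallyIntegrableOn _) key
  rw [Filter.EventuallyEq, ae_restrict_iff' hU.measurableSet]
  filter_upwards [h1] with x hx hxU using sub_eq_zero.1 (hx hxU)

theorem integral_deriv_smul_of_hasDerivAt {f g : ℝ → ℂ} (hf : ∀ x, HasDerivAt f (g x) x)
    (hg : Continuous g) {φ : ℝ → ℝ} (hφ : ContDiff ℝ ∞ φ) (hc : HasCompactSupport φ) :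
    ∫ x, deriv φ x • f x = - ∫ x, φ x • g x := by
  have hfc : Continuous f := continuous_iff_continuousAt.2 fun x => (hf x).continuousAt
  have hd : Continuous (deriv φ) := hφ.continuous_deriv (by simp)
  have := integral_bilinear_hasDerivAt_right_eq_neg_left_of_integrable
    (L := ContinuousLinearMap.lsmul ℝ ℝ) (u := φ) (u' := deriv φ) (v := f) (v' := g)
    (fun x _ => (hφ.differentiable (by simp) x).hasDerivAt) (fun x _ => hf x)
    ((hφ.continuous.smul hg).integrable_of_hasCompactSupport hc.smul_right)
    ((hd.smul hfc).integrable_of_hasCompactSupport hc.deriv.smul_right)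
    ((hφ.continuous.smul hfc).integrable_of_hasCompactSupport hc.smul_right)
  simp only [ContinuousLinearMap.lsmul_apply] at this
  rw [this, neg_neg]

theorem setIntegral_smul_eq_integral {U : Set ℝ} {φ : ℝ → ℝ} (hφ : tsupport φ ⊆ U) (f : ℝ → ℂ) :
    ∫ x in U, φ x • f x = ∫ x, φ x • f x :=
  setIntegral_eq_integral_of_forall_compl_eq_zero fun x hx => by
    rw [image_eq_zero_of_notMem_tsupport fun h => hx (hφ h), zero_smul]

theorem IsWeakDeriv.of_hasDerivAt (U : Set ℝ) {f g : ℝ → ℂ} (hf : ∀ x, HasDerivAt f (g x) x)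
    (hg : Continuous g) : IsWeakDeriv U f g := by
  intro φ hφ hc hU
  rw [setIntegral_smul_eq_integral (tsupport_deriv_subset.trans hU), setIntegral_smul_eq_integral hU,
    integral_deriv_smul_of_hasDerivAt hf hg hφ hc]

theorem IsWeakDeriv.congr_ae {U : Set ℝ} {f g f' g' : ℝ → ℂ} (h : IsWeakDeriv U f g)
    (hf : f =ᵐ[volume.restrict U] f') (hg : g =ᵐ[volume.restrict U] g') : IsWeakDeriv U f' g' := by
  intro φ hφ hc hU
  rw [integral_congr_ae (g := fun x => deriv φ x • f x), h φ hφ hc hU,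
    integral_congr_ae (f := fun x => φ x • g x)]
  · filter_upwards [hg] with x hx using by rw [hx]
  · filter_upwards [hf] with x hx using by rw [hx]

/-- A continuous generalized derivative of a continuous function is a classical derivative. -/
theorem IsWeakDeriv.hasDerivAt {U : Set ℝ} (hU : IsOpen U) (hUc : U.OrdConnected) {f g : ℝ → ℂ}
    (hf : Continuous f) (hg : Continuous g) (h : IsWeakDeriv U f g) {x : ℝ} (hx : x ∈ U) :
    HasDerivAt f (g x) x := by
  -- `f - G` has generalized derivative zero on `U`, so it is constant there.
  set G : ℝ → ℂ := fun x => ∫ t in (0 : ℝ)..x, g t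
  have hG : ∀ x, HasDerivAt G (g x) x := fun x =>
    intervalIntegral.integral_hasDerivAt_right (hg.intervalIntegrable _ _)
      (hg.stronglyMeasurableAtFilter _ _) hg.continuousAt
  have hGc : Continuous G := continuous_iff_continuousAt.2 fun x => (hG x).continuousAt
  obtain ⟨c, hc⟩ := exists_eqOn_const_of_integral_deriv_smul_eq_zero hU hUc ⟨x, hx⟩ (hf.sub hGc) <| by
    intro φ hφ hcs hφU
    have hd : Continuous (deriv φ) := hφ.continuous_deriv (by simp)
    have h1 := h φ hφ hcs hφU
    rw [setIntegral_smul_eq_integral (tsupport_deriv_subset.trans hφU),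
      setIntegral_smul_eq_integral hφU, ← integral_deriv_smul_of_hasDerivAt hG hg hφ hcs] at h1
    simp only [Pi.sub_apply, smul_sub]
    rw [integral_sub, h1, sub_self]
    · exact (hd.smul hf).integrable_of_hasCompactSupport hcs.deriv.smul_right
    · exact (hd.smul hGc).integrable_of_hasCompactSupport hcs.deriv.smul_right
  have h2 : HasDerivAt (fun y => G y + c) (g x) x := (hG x).add_const c
  refine h2.congr_of_eventuallyEq ?_
  filter_upwards [hU.mem_nhds hx] with y hy
  have h3 : f y - G y = c := hc hy
  rw [← h3, add_sub_cancel]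

/-! ### Plane waves on a single line -/

/-- The function `α exp(i k x) + β exp(-i k x)`. -/
noncomputable def planeWave (k α β : ℂ) (x : ℝ) : ℂ :=
  α * Complex.exp (Complex.I * k * x) + β * Complex.exp (-(Complex.I * k * x))

theorem planeWave_zero (k : ℂ) : planeWave k 0 0 = 0 := by
  ext x
  simp [planeWave]

theorem hasDerivAt_planeWave (k α β : ℂ) (x : ℝ) :
    HasDerivAt (planeWave k α β)
      (planeWave k (Complex.I * k * α) (-(Complex.I * k * β)) x) x := by
  have h : HasDerivAt (fun y : ℝ => Complex.I * k * (y : ℂ)) (Complex.I * k) x := by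
    simpa using (Complex.ofRealCLM.hasDerivAt (x := x)).const_mul (Complex.I * k)
  convert! (h.cexp.const_mul α).add (h.neg.cexp.const_mul β) using 1
  simp only [planeWave, Pi.neg_apply]
  ring

theorem continuous_planeWave (k α β : ℂ) : Continuous (planeWave k α β) :=
  continuous_iff_continuousAt.2 fun x => (hasDerivAt_planeWave k α β x).continuousAt

theorem planeWave_deriv_deriv (k α β : ℂ) (x : ℝ) :
    planeWave k (Complex.I * k * (Complex.I * k * α)) (-(Complex.I * k * (-(Complex.I * k * β)))) x =
      -k ^ 2 * planeWave k α β x := by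
  simp only [planeWave]
  linear_combination (k ^ 2 * (α * Complex.exp (Complex.I * k * x) +
    β * Complex.exp (-(Complex.I * k * x)))) * Complex.I_sq

/-- The two exponential solutions are linearly independent on every interval. -/
theorem planeWave_coeff_eq_zero {k α β : ℂ} (hk : k ≠ 0) {b : ℝ} (hb : 0 < b)
    (h : EqOn (planeWave k α β) 0 (Ioo 0 b)) : α = 0 ∧ β = 0 := by
  have hm : b / 2 ∈ Ioo 0 b := ⟨by linarith, by linarith⟩
  have h0 : planeWave k α β (b / 2) = 0 := h hm
  have h1 : planeWave k (Complex.I * k * α) (-(Complex.I * k * β)) (b / 2) = 0 := by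
    have h2 := hasDerivAt_planeWave k α β (b / 2)
    have h3 : HasDerivAt (planeWave k α β) 0 (b / 2) :=
      (hasDerivAt_const (b / 2) (0 : ℂ)).congr_of_eventuallyEq
        (h.eventuallyEq_of_mem (isOpen_Ioo.mem_nhds hm))
    exact h2.unique h3
  simp only [planeWave] at h0 h1
  have hIk : Complex.I * k ≠ 0 := mul_ne_zero Complex.I_ne_zero hk
  set e := Complex.exp (Complex.I * k * ((b / 2 : ℝ) : ℂ)) with he
  set e' := Complex.exp (-(Complex.I * k * ((b / 2 : ℝ) : ℂ))) with he'
  have h2 : α * e - β * e' = 0 := by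
    apply (mul_eq_zero.1 (?_ : Complex.I * k * (α * e - β * e') = 0)).resolve_left hIk
    linear_combination h1
  have h3 : α * e = 0 := by linear_combination (h0 + h2) / 2
  have h4 : β * e' = 0 := by linear_combination (h0 - h2) / 2
  exact ⟨(mul_eq_zero.1 h3).resolve_right (Complex.exp_ne_zero _),
    (mul_eq_zero.1 h4).resolve_right (Complex.exp_ne_zero _)⟩

theorem hasDerivAt_im_conj_mul {f g : ℝ → ℂ} {f' g' : ℂ} {x : ℝ} (hf : HasDerivAt f f' x)
    (hg : HasDerivAt g g' x) :
    HasDerivAt (fun y => (star (f y) * g y).im) ((star f' * g x + star (f x) * g').im) x :=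
  Complex.imCLM.hasFDerivAt.comp_hasDerivAt x (hf.star.mul hg)

/-- Green's formula for a plane wave. -/
theorem im_conj_mul_deriv_planeWave_sub (k α β : ℂ) (b : ℝ) :
    (star (planeWave k α β 0) * planeWave k (Complex.I * k * α) (-(Complex.I * k * β)) 0).im -
      (star (planeWave k α β b) * planeWave k (Complex.I * k * α) (-(Complex.I * k * β)) b).im =
      (k ^ 2).im * ∫ x in 0..b, Complex.normSq (planeWave k α β x) := by
  -- The derivative of `conj(u) u'` is `|u'|² - k²|u|²`, whose first term is real.
  have hd : ∀ x, HasDerivAt (fun y => (star (planeWave k α β y) *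
      planeWave k (Complex.I * k * α) (-(Complex.I * k * β)) y).im)
      (-(k ^ 2).im * Complex.normSq (planeWave k α β x)) x := by
    intro x
    convert! hasDerivAt_im_conj_mul (hasDerivAt_planeWave k α β x)
      (hasDerivAt_planeWave k (Complex.I * k * α) (-(Complex.I * k * β)) x) using 1
    rw [planeWave_deriv_deriv]
    simp only [Complex.normSq_apply, Complex.add_im, Complex.mul_im, Complex.star_def,
      Complex.conj_re, Complex.conj_im, Complex.mul_re, Complex.neg_re, Complex.neg_im]
    ring
  have hc : Continuous fun x => -(k ^ 2).im * Complex.normSq (planeWave k α β x) :=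
    continuous_const.mul (Complex.continuous_normSq.comp (continuous_planeWave k α β))
  have := intervalIntegral.integral_eq_sub_of_hasDerivAt (a := 0) (b := b) (fun x _ => hd x)
    (hc.intervalIntegrable _ _)
  rw [intervalIntegral.integral_const_mul] at this
  linarith

/-! ### Amplitudes, flux and the matrix `Z` for complex `k` -/

section Graph

variable {𝓔 𝓘 : Type*}

/-- The functions on the lines of the graph given by a vector of amplitudes. -/
noncomputable def waves (k : ℂ) (s : 𝓔 ⊕ 𝓘 ⊕ 𝓘 → ℂ) : 𝓔 ⊕ 𝓘 → ℝ → ℂ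
  | .inl e => planeWave k (s (.inl e)) 0
  | .inr i => planeWave k (s (.inr (.inl i))) (s (.inr (.inr i)))

/-- The amplitudes of the derivative. -/
noncomputable def derivAmplitude (k : ℂ) (s : 𝓔 ⊕ 𝓘 ⊕ 𝓘 → ℂ) : 𝓔 ⊕ 𝓘 ⊕ 𝓘 → ℂ
  | .inl e => Complex.I * k * s (.inl e)
  | .inr (.inl i) => Complex.I * k * s (.inr (.inl i))
  | .inr (.inr i) => -(Complex.I * k * s (.inr (.inr i)))

theorem hasDerivAt_waves (k : ℂ) (s : 𝓔 ⊕ 𝓘 ⊕ 𝓘 → ℂ) (j : 𝓔 ⊕ 𝓘) (x : ℝ) :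
    HasDerivAt (waves k s j) (waves k (derivAmplitude k s) j x) x := by
  cases j with
  | inl e => simpa [waves, derivAmplitude] using hasDerivAt_planeWave k (s (.inl e)) 0 x
  | inr i => exact hasDerivAt_planeWave k _ _ x

theorem continuous_waves (k : ℂ) (s : 𝓔 ⊕ 𝓘 ⊕ 𝓘 → ℂ) (j : 𝓔 ⊕ 𝓘) : Continuous (waves k s j) :=
  continuous_iff_continuousAt.2 fun x => (hasDerivAt_waves k s j x).continuousAt

theorem waves_derivAmplitude_derivAmplitude (k : ℂ) (s : 𝓔 ⊕ 𝓘 ⊕ 𝓘 → ℂ) (j : 𝓔 ⊕ 𝓘) (x : ℝ) :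
    waves k (derivAmplitude k (derivAmplitude k s)) j x = -k ^ 2 * waves k s j x := by
  cases j with
  | inl e => simpa [waves, derivAmplitude] using planeWave_deriv_deriv k (s (.inl e)) 0 x
  | inr i => exact planeWave_deriv_deriv k _ _ x

variable [Fintype 𝓔] [Fintype 𝓘]

/-- An external line contributes `Im (conj(s_e) · ik s_e) = Re k |s_e|²`. On an internal line the
sign of the inward derivative at `a i` turns the two end point terms into the difference given by
Green's formula. -/
theorem im_boundaryValue_dotProduct_boundaryDeriv (a : 𝓘 → ℝ) (k : ℂ) (s : 𝓔 ⊕ 𝓘 ⊕ 𝓘 → ℂ) :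
    (star (boundaryValue a (waves k s)) ⬝ᵥ boundaryDeriv a (waves k (derivAmplitude k s))).im =
      k.re * ∑ e, Complex.normSq (s (.inl e)) +
        (k ^ 2).im * ∑ i, ∫ x in 0..a i, Complex.normSq (waves k s (.inr i) x) := by
  simp only [dotProduct, Fintype.sum_sum_type, Complex.add_im, Complex.im_sum, Finset.mul_sum]
  rw [← Finset.sum_add_distrib]
  congr 1
  · refine Finset.sum_congr rfl fun e _ => ?_
    simp only [Pi.star_apply, boundaryValue, boundaryDeriv, waves, derivAmplitude, planeWave,
      Complex.ofReal_zero, mul_zero, Complex.exp_zero, mul_one, zero_mul, add_zero]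
    simp only [Complex.normSq_apply, Complex.mul_im, Complex.mul_re, Complex.star_def,
      Complex.conj_re, Complex.conj_im, Complex.I_re, Complex.I_im]
    ring
  · refine Finset.sum_congr rfl fun i _ => ?_
    simp only [Pi.star_apply, boundaryValue, boundaryDeriv, waves, derivAmplitude, mul_neg,
      Complex.neg_im]
    rw [← sub_eq_add_neg]
    exact im_conj_mul_deriv_planeWave_sub k _ _ _

variable [DecidableEq 𝓔] [DecidableEq 𝓘]

/-- The continuation of `X(k²)` to complex `k`. -/
noncomputable def entireX (a : 𝓘 → ℝ) (k : ℂ) : Matrix (𝓔 ⊕ 𝓘 ⊕ 𝓘) (𝓔 ⊕ 𝓘 ⊕ 𝓘) ℂ :=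
  Matrix.fromBlocks 1 0 0 (Matrix.fromBlocks 1 1
    (Matrix.diagonal fun i => Complex.exp (Complex.I * k * a i))
    (Matrix.diagonal fun i => Complex.exp (-(Complex.I * k * a i))))

/-- The continuation of `Y(k²)` to complex `k`. -/
noncomputable def entireY (a : 𝓘 → ℝ) (k : ℂ) : Matrix (𝓔 ⊕ 𝓘 ⊕ 𝓘) (𝓔 ⊕ 𝓘 ⊕ 𝓘) ℂ :=
  Matrix.fromBlocks 1 0 0 (Matrix.fromBlocks 1 (-1)
    (-Matrix.diagonal fun i => Complex.exp (Complex.I * k * a i))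
    (Matrix.diagonal fun i => Complex.exp (-(Complex.I * k * a i))))

/-- The continuation of `Z_{A,B}(k²)` to complex `k`. -/
noncomputable def entireZ (a : 𝓘 → ℝ) (A B : Matrix (𝓔 ⊕ 𝓘 ⊕ 𝓘) (𝓔 ⊕ 𝓘 ⊕ 𝓘) ℂ) (k : ℂ) :
    Matrix (𝓔 ⊕ 𝓘 ⊕ 𝓘) (𝓔 ⊕ 𝓘 ⊕ 𝓘) ℂ :=
  A * entireX a k + (Complex.I * k) • (B * entireY a k)

theorem matZ_eq_entireZ (a : 𝓘 → ℝ) (A B : Matrix (𝓔 ⊕ 𝓘 ⊕ 𝓘) (𝓔 ⊕ 𝓘 ⊕ 𝓘) ℂ) (E : ℝ) :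
    matZ a A B E = entireZ a A B (Real.sqrt E : ℂ) := by
  simp only [matZ, entireZ, matX, matY, entireX, entireY, expDiag, Complex.ofReal_neg, mul_neg,
    neg_mul]

theorem entireX_mulVec (a : 𝓘 → ℝ) (k : ℂ) (s : 𝓔 ⊕ 𝓘 ⊕ 𝓘 → ℂ) :
    entireX a k *ᵥ s = boundaryValue a (waves k s) := by
  ext (e | i | i) <;>
    simp [entireX, Matrix.fromBlocks_mulVec, Matrix.mulVec_diagonal, boundaryValue, waves, planeWave,
      mul_comm]

theorem smul_entireY_mulVec (a : 𝓘 → ℝ) (k : ℂ) (s : 𝓔 ⊕ 𝓘 ⊕ 𝓘 → ℂ) :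
    (Complex.I * k) • (entireY a k *ᵥ s) = boundaryDeriv a (waves k (derivAmplitude k s)) := by
  ext (e | i | i)
  · simp [entireY, Matrix.fromBlocks_mulVec, boundaryDeriv, waves, planeWave, derivAmplitude]
  · simp [entireY, Matrix.fromBlocks_mulVec, boundaryDeriv, waves, planeWave, derivAmplitude,
      Matrix.neg_mulVec]
    ring
  · simp [entireY, Matrix.fromBlocks_mulVec, boundaryDeriv, waves, planeWave, derivAmplitude,
      Matrix.neg_mulVec, Matrix.mulVec_diagonal]
    ring

/-- The dictionary between the kernel of `Z` and waves satisfying the boundary conditions, with no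
regard to square integrability. -/
theorem entireZ_mulVec (a : 𝓘 → ℝ) (A B : Matrix (𝓔 ⊕ 𝓘 ⊕ 𝓘) (𝓔 ⊕ 𝓘 ⊕ 𝓘) ℂ) (k : ℂ)
    (s : 𝓔 ⊕ 𝓘 ⊕ 𝓘 → ℂ) :
    entireZ a A B k *ᵥ s = A *ᵥ boundaryValue a (waves k s) +
      B *ᵥ boundaryDeriv a (waves k (derivAmplitude k s)) := by
  rw [entireZ, Matrix.add_mulVec, ← entireX_mulVec, ← smul_entireY_mulVec, Matrix.smul_mulVec,
    Matrix.mulVec_smul, Matrix.mulVec_mulVec, Matrix.mulVec_mulVec]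

/-! ### Zeros of the entire function `det Z` -/

theorem differentiable_det {n : Type*} [Fintype n] [DecidableEq n] {M : ℂ → Matrix n n ℂ}
    (hM : ∀ i j, Differentiable ℂ fun k => M k i j) : Differentiable ℂ fun k => (M k).det := by
  simp only [Matrix.det_apply]
  exact Differentiable.fun_sum fun σ _ =>
    (Differentiable.fun_finsetProd fun i _ => hM _ _).const_smul _

theorem differentiable_det_entireZ (a : 𝓘 → ℝ) (A B : Matrix (𝓔 ⊕ 𝓘 ⊕ 𝓘) (𝓔 ⊕ 𝓘 ⊕ 𝓘) ℂ) :
    Differentiable ℂ fun k => (entireZ a A B k).det := by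
  have hdiag : ∀ (f : 𝓘 → ℂ → ℂ), (∀ i, Differentiable ℂ (f i)) → ∀ i j,
      Differentiable ℂ fun k => Matrix.diagonal (fun l => f l k) i j := by
    intro f hf i j
    by_cases h : i = j
    · subst h
      simpa using hf i
    · simp [h]
  have h1 := hdiag (fun i k => Complex.exp (Complex.I * k * a i)) fun i => by fun_prop
  have h2 := hdiag (fun i k => Complex.exp (-(Complex.I * k * a i))) fun i => by fun_prop
  have hX : ∀ i j, Differentiable ℂ fun k => (entireX a k : Matrix (𝓔 ⊕ 𝓘 ⊕ 𝓘) _ ℂ) i j := by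
    rintro (e | i | i) (f | j | j) <;>
      first | exact differentiable_const _ | exact h1 i j | exact h2 i j
  have hY : ∀ i j, Differentiable ℂ fun k => (entireY a k : Matrix (𝓔 ⊕ 𝓘 ⊕ 𝓘) _ ℂ) i j := by
    rintro (e | i | i) (f | j | j) <;>
      first | exact differentiable_const _ | exact (h1 i j).neg | exact h2 i j
  refine differentiable_det fun i j => ?_
  simp only [entireZ, Matrix.add_apply, Matrix.smul_apply, Matrix.mul_apply, smul_eq_mul]
  exact (Differentiable.fun_sum fun l _ => (hX l j).const_mul _).add
    ((differentiable_id.const_mul _).mul (Differentiable.fun_sum fun l _ => (hY l j).const_mul _))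

/-- Amplitudes in the kernel of `Z` vanish on the external lines, and also on the internal lines
unless `k²` is real. -/
theorem amplitude_eq_zero_of_entireZ_mulVec_eq_zero {a : 𝓘 → ℝ} (ha : ∀ i, 0 < a i)
    {A B : Matrix (𝓔 ⊕ 𝓘 ⊕ 𝓘) (𝓔 ⊕ 𝓘 ⊕ 𝓘) ℂ}
    (hrank : (Matrix.fromCols A B).rank = Fintype.card (𝓔 ⊕ 𝓘 ⊕ 𝓘)) (hAB : (A * Bᴴ).IsHermitian)
    {k : ℂ} (hk : 0 < k.re) (hk2 : 0 ≤ (k ^ 2).im) {s : 𝓔 ⊕ 𝓘 ⊕ 𝓘 → ℂ}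
    (hs : entireZ a A B k *ᵥ s = 0) :
    (∀ e, s (.inl e) = 0) ∧ (0 < (k ^ 2).im → s = 0) := by
  rw [entireZ_mulVec] at hs
  have h := im_star_dotProduct_eq_zero hrank hAB hs
  rw [im_boundaryValue_dotProduct_boundaryDeriv] at h
  have hi : ∀ i, 0 ≤ ∫ x in 0..a i, Complex.normSq (waves k s (.inr i) x) := fun i =>
    intervalIntegral.integral_nonneg (ha i).le fun x _ => Complex.normSq_nonneg _
  -- The flux is zero and is a sum of two nonnegative terms, so each term vanishes.
  have h1 : 0 ≤ k.re * ∑ e, Complex.normSq (s (.inl e)) :=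
    mul_nonneg hk.le (Finset.sum_nonneg fun e _ => Complex.normSq_nonneg _)
  have h2 : 0 ≤ (k ^ 2).im * ∑ i, ∫ x in 0..a i, Complex.normSq (waves k s (.inr i) x) :=
    mul_nonneg hk2 (Finset.sum_nonneg fun i _ => hi i)
  have he : ∀ e, s (.inl e) = 0 := by
    have h3 : k.re * ∑ e, Complex.normSq (s (.inl e)) = 0 := by linarith
    have h4 := (mul_eq_zero.1 h3).resolve_left hk.ne'
    rw [Finset.sum_eq_zero_iff_of_nonneg fun e _ => Complex.normSq_nonneg _] at h4
    exact fun e => Complex.normSq_eq_zero.1 (h4 e (Finset.mem_univ e))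
  refine ⟨he, fun hpos => ?_⟩
  have h3 : (k ^ 2).im * ∑ i, ∫ x in 0..a i, Complex.normSq (waves k s (.inr i) x) = 0 := by
    linarith
  have h4 := (mul_eq_zero.1 h3).resolve_left hpos.ne'
  rw [Finset.sum_eq_zero_iff_of_nonneg fun i _ => hi i] at h4
  have hc : ∀ i, s (.inr (.inl i)) = 0 ∧ s (.inr (.inr i)) = 0 := by
    intro i
    refine planeWave_coeff_eq_zero (k := k) (fun h0 => by simp [h0] at hk) (ha i) ?_
    have h5 := h4 i (Finset.mem_univ i)
    have hcont : Continuous fun x => Complex.normSq (waves k s (.inr i) x) :=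
      Complex.continuous_normSq.comp (continuous_waves k s _)
    rw [intervalIntegral.integral_eq_zero_iff_of_le_of_nonneg_ae (ha i).le
      (Eventually.of_forall fun x => Complex.normSq_nonneg _) (hcont.intervalIntegrable _ _)] at h5
    have h6 := Measure.eqOn_open_of_ae_eq
      (ae_restrict_of_ae_restrict_of_subset Ioo_subset_Ioc_self h5) isOpen_Ioo
      hcont.continuousOn continuousOn_const
    exact fun x hx => Complex.normSq_eq_zero.1 (h6 hx)
  ext (e | i | i)
  · exact he e
  · exact (hc i).1
  · exact (hc i).2

theorem exists_det_entireZ_ne_zero {a : 𝓘 → ℝ} (ha : ∀ i, 0 < a i)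
    {A B : Matrix (𝓔 ⊕ 𝓘 ⊕ 𝓘) (𝓔 ⊕ 𝓘 ⊕ 𝓘) ℂ}
    (hrank : (Matrix.fromCols A B).rank = Fintype.card (𝓔 ⊕ 𝓘 ⊕ 𝓘))
    (hAB : (A * Bᴴ).IsHermitian) : ∃ k, (entireZ a A B k).det ≠ 0 := by
  -- Any point of the open first quadrant would do; here `k² = 2i`.
  have him : 0 < ((1 + Complex.I) ^ 2).im := by norm_num [sq]
  refine ⟨1 + Complex.I, fun h => ?_⟩
  obtain ⟨s, hs0, hs⟩ := Matrix.exists_mulVec_eq_zero_iff.2 h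
  exact hs0 ((amplitude_eq_zero_of_entireZ_mulVec_eq_zero ha hrank hAB (by simp) him.le hs).2 him)

/-- By the identity theorem the zeros of `det Z` are isolated in the `k`-plane, and this is pulled
back along the continuous map `E ↦ √E`. The point `E = 0` is not special, since the determinant is
holomorphic around `k = 0`. -/
theorem not_accPt_exceptionalSet {a : 𝓘 → ℝ} (ha : ∀ i, 0 < a i)
    {A B : Matrix (𝓔 ⊕ 𝓘 ⊕ 𝓘) (𝓔 ⊕ 𝓘 ⊕ 𝓘) ℂ}
    (hrank : (Matrix.fromCols A B).rank = Fintype.card (𝓔 ⊕ 𝓘 ⊕ 𝓘))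
    (hAB : (A * Bᴴ).IsHermitian) (x : ℝ) : ¬ AccPt x (𝓟 (exceptionalSet a A B)) := by
  obtain ⟨k₀, hk₀⟩ := exists_det_entireZ_ne_zero ha hrank hAB
  have han : AnalyticOnNhd ℂ (fun k => (entireZ a A B k).det) univ := fun k _ =>
    (differentiable_det_entireZ a A B).analyticAt k
  have hne : ∀ᶠ k in 𝓝[≠] (Real.sqrt x : ℂ), (entireZ a A B k).det ≠ 0 := by
    by_contra hf
    have := han.eqOn_zero_of_preconnected_of_frequently_eq_zero isPreconnected_univ (mem_univ _)
      hf
    exact hk₀ (this (mem_univ k₀))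
  have ht : Tendsto (fun y : ℝ => (Real.sqrt y : ℂ)) (𝓝 x) (𝓝 (Real.sqrt x : ℂ)) :=
    (Complex.continuous_ofReal.comp Real.continuous_sqrt).tendsto x
  rw [accPt_iff_frequently, Filter.not_frequently]
  filter_upwards [ht.eventually (eventually_nhdsWithin_iff.1 hne)] with y hy
  rintro ⟨hyx, hy0, hdet⟩
  rw [matZ_eq_entireZ] at hdet
  refine hy ?_ hdet
  rw [mem_compl_iff, mem_singleton_iff, Complex.ofReal_inj]
  intro h
  -- `Real.sqrt` is zero on all of `(-∞, 0]`, but the points `y` of the set are positive, so `√y ≠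
  -- √x` there too.
  rcases le_or_gt x 0 with hx | hx
  · rw [Real.sqrt_eq_zero_of_nonpos hx] at h
    exact (Real.sqrt_pos.2 hy0).ne' h
  · exact hyx ((Real.sqrt_inj hy0.le hx.le).1 h)

theorem isDiscrete_of_forall_not_accPt {X : Type*} [TopologicalSpace X] {S : Set X}
    (h : ∀ x, ¬ AccPt x (𝓟 S)) : IsDiscrete S := by
  rw [isDiscrete_iff_nhdsNE]
  intro x _
  simpa [AccPt, Filter.neBot_iff] using h x

end Graph

/-! ### Eigenfunctions are plane waves on every line -/

section Graph

variable {𝓔 𝓘 : Type*}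

theorem zero_mem_edge {a : 𝓘 → ℝ} (ha : ∀ i, 0 < a i) (j : 𝓔 ⊕ 𝓘) : (0 : ℝ) ∈ edge a j := by
  cases j with
  | inl e => exact mem_Ici.2 le_rfl
  | inr i => exact ⟨le_rfl, (ha i).le⟩

theorem isClosed_edge (a : 𝓘 → ℝ) (j : 𝓔 ⊕ 𝓘) : IsClosed (edge a j) := by
  cases j with
  | inl e => exact isClosed_Ici
  | inr i => exact isClosed_Icc

theorem ordConnected_interior_edge (a : 𝓘 → ℝ) (j : 𝓔 ⊕ 𝓘) :
    (interior (edge a j)).OrdConnected := by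
  cases j with
  | inl e => simpa [edge] using ordConnected_Ioi
  | inr i => simpa [edge] using ordConnected_Ioo

theorem closure_interior_edge {a : 𝓘 → ℝ} (ha : ∀ i, 0 < a i) (j : 𝓔 ⊕ 𝓘) :
    closure (interior (edge a j)) = edge a j := by
  cases j with
  | inl e => simp [edge]
  | inr i => simp [edge, (ha i).ne]

/-- The element of the Hilbert space with given components. -/
noncomputable def ofFun {a : 𝓘 → ℝ} (f : 𝓔 ⊕ 𝓘 → ℝ → ℂ)
    (hf : ∀ j, MemLp (f j) 2 (volume.restrict (edge a j))) : HilbertSpace 𝓔 a :=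
  WithLp.toLp 2 fun j => (hf j).toLp (f j)

theorem ofFun_ae_eq {a : 𝓘 → ℝ} {f : 𝓔 ⊕ 𝓘 → ℝ → ℂ}
    (hf : ∀ j, MemLp (f j) 2 (volume.restrict (edge a j))) (j : 𝓔 ⊕ 𝓘) :
    (ofFun f hf j : ℝ → ℂ) =ᵐ[volume.restrict (edge a j)] f j :=
  (hf j).coeFn_toLp

theorem isContRep_ofFun {a : 𝓘 → ℝ} {f : 𝓔 ⊕ 𝓘 → ℝ → ℂ} (hc : ∀ j, Continuous (f j))
    (hf : ∀ j, MemLp (f j) 2 (volume.restrict (edge a j))) : IsContRep (ofFun f hf) f :=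
  fun j => ⟨(hc j).continuousOn, ofFun_ae_eq hf j⟩

theorem IsWeakDerivOnGraph.of_hasDerivAt {a : 𝓘 → ℝ} {ψ χ : HilbertSpace 𝓔 a}
    {f g : 𝓔 ⊕ 𝓘 → ℝ → ℂ} (hf : IsContRep ψ f) (hg : IsContRep χ g)
    (hgc : ∀ j, Continuous (g j)) (hd : ∀ j x, HasDerivAt (f j) (g j x) x) :
    IsWeakDerivOnGraph ψ χ := fun j =>
  (IsWeakDeriv.of_hasDerivAt _ (hd j) (hgc j)).congr_ae
    (by rw [restrict_interior_edge]; exact (hf j).2.symm)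
    (by rw [restrict_interior_edge]; exact (hg j).2.symm)

theorem IsContRep.smul {a : 𝓘 → ℝ} {ψ : HilbertSpace 𝓔 a} {u : 𝓔 ⊕ 𝓘 → ℝ → ℂ}
    (h : IsContRep ψ u) (c : ℂ) : IsContRep (c • ψ) (c • u) := fun j =>
  ⟨(h j).1.const_smul c, (Lp.coeFn_smul c (ψ j)).trans ((h j).2.const_smul c)⟩

/-- Tietze extension; it makes the results on functions continuous on all of `ℝ` available for
representatives continuous only on a closed line. -/
theorem exists_continuous_eqOn {S : Set ℝ} (hS : IsClosed S) {u : ℝ → ℂ} (hu : ContinuousOn u S) :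
    ∃ f : ℝ → ℂ, Continuous f ∧ EqOn f u S := by
  obtain ⟨g, hg⟩ := ContinuousMap.exists_restrict_eq hS ⟨S.domRestrict u, hu.domRestrict⟩
  exact ⟨g, g.continuous, fun x hx => DFunLike.congr_fun hg (⟨x, hx⟩ : S)⟩

theorem IsWeakDerivOnGraph.hasDerivAt {a : 𝓘 → ℝ} {ψ χ : HilbertSpace 𝓔 a}
    {u v : 𝓔 ⊕ 𝓘 → ℝ → ℂ} (h : IsWeakDerivOnGraph ψ χ) (hu : IsContRep ψ u) (hv : IsContRep χ v)
    (j : 𝓔 ⊕ 𝓘) {x : ℝ} (hx : x ∈ interior (edge a j)) : HasDerivAt (u j) (v j x) x := by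
  obtain ⟨f, hf, hfu⟩ := exists_continuous_eqOn (isClosed_edge a j) (hu j).1
  obtain ⟨g, hg, hgv⟩ := exists_continuous_eqOn (isClosed_edge a j) (hv j).1
  have hm : ∀ᵐ x ∂volume.restrict (edge a j), x ∈ edge a j :=
    ae_restrict_mem (isClosed_edge a j).measurableSet
  have h1 : IsWeakDeriv (interior (edge a j)) f g := by
    refine (h j).congr_ae ?_ ?_
    · rw [restrict_interior_edge]
      filter_upwards [(hu j).2, hm] with x h1 h2 using by rw [h1, hfu h2]
    · rw [restrict_interior_edge]
      filter_upwards [(hv j).2, hm] with x h1 h2 using by rw [h1, hgv h2]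
  have h2 := h1.hasDerivAt isOpen_interior (ordConnected_interior_edge a j) hf hg hx
  rw [hgv (interior_subset hx)] at h2
  refine h2.congr_of_eventuallyEq ?_
  filter_upwards [isOpen_interior.mem_nhds hx] with y hy using (hfu (interior_subset hy)).symm

/-- First integrals of `u'' = κ² u`. -/
theorem exists_add_mul_eq_exp {S : Set ℝ} (hS : IsPreconnected (interior S))
    (hcl : closure (interior S) = S) {u v : ℝ → ℂ} (hu : ContinuousOn u S) (hv : ContinuousOn v S)
    {κ : ℂ} (hu' : ∀ x ∈ interior S, HasDerivAt u (v x) x)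
    (hv' : ∀ x ∈ interior S, HasDerivAt v (κ ^ 2 * u x) x) :
    ∃ c, ∀ x ∈ S, v x + κ * u x = c * Complex.exp (κ * x) := by
  -- Since `(u' + κu)' = κ(u' + κu)`, the function `p` is constant in the interior, and by
  -- continuity up to the end points.
  set p : ℝ → ℂ := fun x => (v x + κ * u x) * Complex.exp (-(κ * x))
  have hp : ∀ x ∈ interior S, HasDerivAt p 0 x := by
    intro x hx
    have h : HasDerivAt (fun y : ℝ => κ * (y : ℂ)) κ x := by
      simpa using (Complex.ofRealCLM.hasDerivAt (x := x)).const_mul κ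
    convert! ((hv' x hx).add ((hu' x hx).const_mul κ)).mul h.neg.cexp using 1
    simp only [Pi.neg_apply, Pi.add_apply]
    ring
  obtain ⟨c, hc⟩ := isOpen_interior.exists_is_const_of_deriv_eq_zero hS
    (fun x hx => (hp x hx).differentiableAt.differentiableWithinAt) fun x hx => (hp x hx).deriv
  have hpc : ContinuousOn p S :=
    (hv.add (continuousOn_const.mul hu)).mul (by fun_prop)
  have hS' : EqOn p (fun _ => c) S :=
    EqOn.of_subset_closure (fun x hx => hc x hx) hpc continuousOn_const interior_subset hcl.superset
  refine ⟨c, fun x hx => ?_⟩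
  have hpx : p x = c := hS' hx
  rw [← hpx]
  simp only [p]
  rw [mul_assoc, ← Complex.exp_add, neg_add_cancel, Complex.exp_zero, mul_one]

/-- An exponential `c exp(i k x)` that is square integrable on the half line vanishes. -/
theorem eq_zero_of_memLp_exp {f : ℝ → ℂ} (hf : MemLp f 2 (volume.restrict (Ici 0))) {c κ : ℂ}
    (hκ : κ.re = 0) (h : ∀ᵐ x ∂volume.restrict (Ici 0), f x = c * Complex.exp (κ * x)) : c = 0 := by
  -- For imaginary `κ` one has `|f| = |c|` almost everywhere, and the half line has infinite
  -- measure.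
  have h1 : MemLp (fun _ : ℝ => c) 2 (volume.restrict (Ici 0)) := by
    refine hf.of_le aestronglyMeasurable_const ?_
    filter_upwards [h] with x hx
    rw [hx, norm_mul, Complex.norm_exp]
    simp [hκ]
  rw [memLp_const_iff two_ne_zero ENNReal.ofNat_ne_top] at h1
  simpa using h1

/-- The amplitudes of an eigenfunction. -/
theorem exists_amplitude {a : 𝓘 → ℝ} (ha : ∀ i, 0 < a i) {ψ ψ' : HilbertSpace 𝓔 a}
    {u v : 𝓔 ⊕ 𝓘 → ℝ → ℂ} {k : ℝ} (hk : 0 < k) (h1 : IsWeakDerivOnGraph ψ ψ')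
    (h2 : IsWeakDerivOnGraph ψ' ((-(k : ℂ) ^ 2) • ψ)) (hu : IsContRep ψ u) (hv : IsContRep ψ' v) :
    ∃ s : 𝓔 ⊕ 𝓘 ⊕ 𝓘 → ℂ, ∀ j, EqOn (u j) (waves k s j) (edge a j) ∧
      EqOn (v j) (waves k (derivAmplitude k s) j) (edge a j) := by
  have hI : Complex.I * k ≠ 0 :=
    mul_ne_zero Complex.I_ne_zero (Complex.ofReal_ne_zero.2 hk.ne')
  have key : ∀ κ : ℂ, κ ^ 2 = -(k : ℂ) ^ 2 → ∀ j, ∃ c, ∀ x ∈ edge a j,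
      v j x + κ * u j x = c * Complex.exp (κ * x) := by
    intro κ hκ j
    refine exists_add_mul_eq_exp (ordConnected_interior_edge a j).isPreconnected
      (closure_interior_edge ha j) (hu j).1 (hv j).1 (fun x hx => h1.hasDerivAt hu hv j hx) ?_
    intro x hx
    rw [hκ]
    exact h2.hasDerivAt hv (hu.smul _) j hx
  have hzero : ∀ κ : ℂ, κ.re = 0 → ∀ (e : 𝓔) c, (∀ x ∈ edge a (.inl e),
      v (.inl e) x + κ * u (.inl e) x = c * Complex.exp (κ * x)) → c = 0 := by
    intro κ hκ e c hc
    refine eq_zero_of_memLp_exp (f := fun x => ψ' (.inl e) x + κ * ψ (.inl e) x)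
      ((Lp.memLp (ψ' (.inl e))).add ((Lp.memLp (ψ (.inl e))).const_mul κ)) hκ ?_
    filter_upwards [(hu (.inl e)).2, (hv (.inl e)).2, ae_restrict_mem measurableSet_Ici]
      with x h1 h2 hx
    rw [h1, h2, hc x hx]
  have hsq : ∀ σ : ℂ, σ ^ 2 = 1 → (σ * (Complex.I * k)) ^ 2 = -(k : ℂ) ^ 2 := by
    intro σ hσ
    rw [mul_pow, mul_pow, hσ, Complex.I_sq]
    ring
  choose c hc using key (Complex.I * k) (by simpa using hsq 1 (by norm_num))
  choose d hd using key (-(Complex.I * k)) (by simpa using hsq (-1) (by norm_num))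
  -- The same argument would give `c = 0`, but only the `exp(-ikx)` part has to go, as `waves` keeps
  -- `exp(ikx)` on external lines.
  have hd0 : ∀ e, d (.inl e) = 0 := fun e => hzero _ (by simp) e _ (hd (.inl e))
  -- The first integrals `v + iku = c exp(ikx)` and `v - iku = d exp(-ikx)` are solved for `u` and
  -- `v`.
  have hrep : ∀ j, ∀ x ∈ edge a j,
      u j x = planeWave k (c j / (2 * (Complex.I * k))) (-d j / (2 * (Complex.I * k))) x ∧
      v j x = planeWave k (Complex.I * k * (c j / (2 * (Complex.I * k))))
        (-(Complex.I * k * (-d j / (2 * (Complex.I * k))))) x := by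
    intro j x hx
    have e1 := hc j x hx
    have e2 := hd j x hx
    rw [neg_mul (Complex.I * k) (x : ℂ)] at e2
    simp only [planeWave]
    set E₁ := Complex.exp (Complex.I * k * x)
    set E₂ := Complex.exp (-(Complex.I * k * x))
    set κ := Complex.I * (k : ℂ)
    constructor
    · field_simp
      linear_combination e1 - e2
    · field_simp
      linear_combination e1 + e2
  refine ⟨Sum.elim (fun e => c (.inl e) / (2 * (Complex.I * k))) (Sum.elim
    (fun i => c (.inr i) / (2 * (Complex.I * k))) fun i => -d (.inr i) / (2 * (Complex.I * k))), ?_⟩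
  rintro (e | i)
  · have := hrep (.inl e)
    simp only [hd0, neg_zero, zero_div, mul_zero] at this
    exact ⟨fun x hx => (this x hx).1, fun x hx => (this x hx).2⟩
  · exact ⟨fun x hx => (hrep (.inr i) x hx).1, fun x hx => (hrep (.inr i) x hx).2⟩

theorem boundaryValue_congr {a : 𝓘 → ℝ} (ha : ∀ i, 0 < a i) {u w : 𝓔 ⊕ 𝓘 → ℝ → ℂ}
    (h : ∀ j, EqOn (u j) (w j) (edge a j)) : boundaryValue a u = boundaryValue a w := by
  ext (e | i | i)
  · exact h _ (zero_mem_edge ha _)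
  · exact h _ (zero_mem_edge ha _)
  · exact h (.inr i) ⟨(ha i).le, le_rfl⟩

theorem boundaryDeriv_congr {a : 𝓘 → ℝ} (ha : ∀ i, 0 < a i) {u w : 𝓔 ⊕ 𝓘 → ℝ → ℂ}
    (h : ∀ j, EqOn (u j) (w j) (edge a j)) : boundaryDeriv a u = boundaryDeriv a w := by
  ext (e | i | i)
  · exact h _ (zero_mem_edge ha _)
  · exact h _ (zero_mem_edge ha _)
  · exact congrArg Neg.neg (h (.inr i) ⟨(ha i).le, le_rfl⟩)

/-! ### Eigenvalues and the kernel of `Z` -/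

variable [Fintype 𝓔] [Fintype 𝓘]

theorem isEigenvalue_neg_laplacian_iff {a : 𝓘 → ℝ} {A B : Matrix (𝓔 ⊕ 𝓘 ⊕ 𝓘) (𝓔 ⊕ 𝓘 ⊕ 𝓘) ℂ}
    {μ : ℂ} : IsEigenvalue (-laplacian a A B) μ ↔
      ∃ ψ : HilbertSpace 𝓔 a, ψ ≠ 0 ∧ (ψ, (-μ) • ψ) ∈ laplacianGraph a A B := by
  rw [← laplacian_graph]
  constructor
  · rintro ⟨ψ, h0, h⟩
    refine ⟨ψ, h0, ?_⟩
    rw [LinearPMap.mem_graph_iff]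
    refine ⟨ψ, rfl, ?_⟩
    rw [LinearPMap.neg_apply] at h
    rw [neg_smul, ← h, neg_neg]
  · rintro ⟨ψ, h0, h⟩
    rw [LinearPMap.mem_graph_iff] at h
    obtain ⟨φ, hφ, h⟩ := h
    change (φ : HilbertSpace 𝓔 a) = ψ at hφ
    change laplacian a A B φ = (-μ) • ψ at h
    refine ⟨φ, by rwa [hφ], ?_⟩
    rw [LinearPMap.neg_apply, h, neg_smul, neg_neg, hφ]

variable [DecidableEq 𝓔] [DecidableEq 𝓘]

theorem positiveEigenvalues_subset {a : 𝓘 → ℝ} (ha : ∀ i, 0 < a i)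
    (A B : Matrix (𝓔 ⊕ 𝓘 ⊕ 𝓘) (𝓔 ⊕ 𝓘 ⊕ 𝓘) ℂ) :
    positiveEigenvalues a A B ⊆ exceptionalSet a A B := by
  rintro E ⟨hE, h⟩
  refine ⟨hE, ?_⟩
  obtain ⟨ψ, h0, ψ', h1, h2, u, v, hu, hv, hbc⟩ := isEigenvalue_neg_laplacian_iff.1 h
  have hE2 : (E : ℂ) = (Real.sqrt E : ℂ) ^ 2 := by rw [← Complex.ofReal_pow, Real.sq_sqrt hE.le]
  rw [hE2] at h2
  obtain ⟨s, hs⟩ := exists_amplitude ha (Real.sqrt_pos.2 hE) h1 h2 hu hv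
  rw [boundaryValue_congr ha fun j => (hs j).1, boundaryDeriv_congr ha fun j => (hs j).2,
    ← entireZ_mulVec, ← matZ_eq_entireZ] at hbc
  refine Matrix.exists_mulVec_eq_zero_iff.1 ⟨s, ?_, hbc⟩
  rintro rfl
  apply h0
  ext1 j
  rw [PiLp.zero_apply, Lp.eq_zero_iff_ae_eq_zero]
  filter_upwards [(hu j).2, ae_restrict_mem (isClosed_edge a j).measurableSet] with x h1 hx
  rw [h1, (hs j).1 hx]
  cases j <;> simp [waves, planeWave_zero]

/-- The rank and symmetry conditions enter through the flux identity: it removes the external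
amplitudes of a kernel vector, so that its waves live on the compact internal lines and are square
integrable. -/
theorem exceptionalSet_subset {a : 𝓘 → ℝ} (ha : ∀ i, 0 < a i)
    {A B : Matrix (𝓔 ⊕ 𝓘 ⊕ 𝓘) (𝓔 ⊕ 𝓘 ⊕ 𝓘) ℂ}
    (hrank : (Matrix.fromCols A B).rank = Fintype.card (𝓔 ⊕ 𝓘 ⊕ 𝓘))
    (hAB : (A * Bᴴ).IsHermitian) : exceptionalSet a A B ⊆ positiveEigenvalues a A B := by
  rintro E ⟨hE, hdet⟩
  refine ⟨hE, isEigenvalue_neg_laplacian_iff.2 ?_⟩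
  have hk := Real.sqrt_pos.2 hE
  have hE2 : (E : ℂ) = (Real.sqrt E : ℂ) ^ 2 := by rw [← Complex.ofReal_pow, Real.sq_sqrt hE.le]
  rw [matZ_eq_entireZ] at hdet
  rw [hE2]
  set k := Real.sqrt E
  obtain ⟨s, hs0, hs⟩ := Matrix.exists_mulVec_eq_zero_iff.2 hdet
  have he := (amplitude_eq_zero_of_entireZ_mulVec_eq_zero ha hrank hAB (by simpa using hk)
    (by simp [← Complex.ofReal_pow]) hs).1
  -- Stated for general amplitudes because it is needed for the function and for its derivative.
  have hmem : ∀ r : 𝓔 ⊕ 𝓘 ⊕ 𝓘 → ℂ, (∀ e, r (.inl e) = 0) → ∀ j,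
      MemLp (waves k r j) 2 (volume.restrict (edge a j)) := by
    rintro r hr (e | i)
    · simp [waves, hr, planeWave_zero]
    · have hc := continuous_waves (k : ℂ) r (.inr i)
      obtain ⟨C, hC⟩ := isCompact_Icc.exists_bound_of_continuousOn (s := Icc 0 (a i)) hc.continuousOn
      have : IsFiniteMeasure (volume.restrict (edge (𝓔 := 𝓔) a (.inr i))) :=
        isFiniteMeasure_restrict.2 isCompact_Icc.measure_lt_top.ne
      refine .of_bound hc.aestronglyMeasurable C ?_
      filter_upwards [ae_restrict_mem measurableSet_Icc] with x hx using hC x hx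
  have hm := hmem s he
  have hm' := hmem (derivAmplitude k s) fun e => by simp [derivAmplitude, he]
  have hr := isContRep_ofFun (continuous_waves (k : ℂ) s) hm
  have hr' := isContRep_ofFun (continuous_waves (k : ℂ) (derivAmplitude k s)) hm'
  refine ⟨ofFun _ hm, ?_, ofFun _ hm', ?_, ?_, _, _, hr, hr', ?_⟩
  · intro h0
    apply hs0
    have hc : ∀ i, s (.inr (.inl i)) = 0 ∧ s (.inr (.inr i)) = 0 := by
      intro i
      refine planeWave_coeff_eq_zero (k := k) (Complex.ofReal_ne_zero.2 hk.ne') (ha i) ?_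
      have h1 := ofFun_ae_eq hm (.inr i)
      rw [h0] at h1
      have h2 : waves (k : ℂ) s (.inr i) =ᵐ[volume.restrict (edge (𝓔 := 𝓔) a (.inr i))] 0 :=
        h1.symm.trans (Lp.coeFn_zero _ _ _)
      exact Measure.eqOn_open_of_ae_eq
        (ae_restrict_of_ae_restrict_of_subset Ioo_subset_Icc_self h2) isOpen_Ioo
        (continuous_waves (k : ℂ) s (.inr i)).continuousOn continuousOn_const
    ext (e | i | i)
    · exact he e
    · exact (hc i).1
    · exact (hc i).2
  · exact .of_hasDerivAt hr hr' (continuous_waves _ _) (hasDerivAt_waves _ _)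
  · refine .of_hasDerivAt hr' (hr.smul _) (fun j => (continuous_waves k s j).const_smul (-(k : ℂ) ^ 2)) ?_
    intro j x
    have := hasDerivAt_waves k (derivAmplitude k s) j x
    rwa [waves_derivAmplitude_derivAmplitude] at this
  · rw [← entireZ_mulVec, hs]

end Graph

end QuantumGraph

theorem theorem3p1 {𝓔 𝓘 : Type*} [Fintype 𝓔] [Fintype 𝓘] [DecidableEq 𝓔] [DecidableEq 𝓘]
    (a : 𝓘 → ℝ) (ha : ∀ i, 0 < a i)
    (A B : Matrix (𝓔 ⊕ 𝓘 ⊕ 𝓘) (𝓔 ⊕ 𝓘 ⊕ 𝓘) ℂ)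
    (hrank : (Matrix.fromCols A B).rank = Fintype.card (𝓔 ⊕ 𝓘 ⊕ 𝓘))
    (hAB : (A * Bᴴ).IsHermitian) :
    QuantumGraph.exceptionalSet a A B = QuantumGraph.positiveEigenvalues a A B ∧
      IsDiscrete (QuantumGraph.exceptionalSet a A B) ∧
      ∀ x : ℝ, ¬ AccPt x (𝓟 (QuantumGraph.exceptionalSet a A B)) := by
  have hacc := QuantumGraph.not_accPt_exceptionalSet ha hrank hAB
  exact ⟨(QuantumGraph.exceptionalSet_subset ha hrank hAB).antisymm
    (QuantumGraph.positiveEigenvalues_subset ha A B),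
    QuantumGraph.isDiscrete_of_forall_not_accPt hacc, hacc⟩
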